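/- For integers $s,t\ge 2$ and $n\ge 1$ let $$f_{s,t}(n)=\min_G\ \max\{|W| : W\subseteq V(G),\ G[W]\text{ contains no copy of }K_s\},$$ where the minimum is taken over all $K_t$-free graphs $G$ on $n$ vertices. Theorem. For every integer $s\ge 3$ there is a constant $c=c(s)>0$ such that for every integer $n\ge 2$ $$f_{s,s+1}(n)\le c\,(\log n)^{4s^2}\sqrt n ,$$ and there is a $K_{s+1}$-free graph $G$ on $n$ vertices such that every set $W\subseteq V(G)$ with $|W|\ge c\,(\log n)^{4s^2}\sqrt n$ contains the vertices of a copy of $K_s$ in $G$. Here $\log$ is the natural logarithm. -/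

import Mathlib

/-- The `s`-independence number `α_s(G)`: the largest size of a vertex set `W` such that the
subgraph of `G` induced on `W` contains no copy of the complete graph `K_s`. -/
noncomputable def sIndepNum {V : Type*} (G : SimpleGraph V) (s : ℕ) : ℕ :=
  sSup {k : ℕ | ∃ W : Finset V, W.card = k ∧ G.CliqueFreeOn (W : Set V) s}

/-- On a finite vertex set and for `s ≥ 1` the supremum in `sIndepNum` is a maximum. -/
theorem isGreatest_sIndepNum {V : Type*} [Fintype V] (G : SimpleGraph V) {s : ℕ} (hs : 1 ≤ s) :
    IsGreatest {k : ℕ | ∃ W : Finset V, W.card = k ∧ G.CliqueFreeOn (W : Set V) s}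
      (sIndepNum G s) := by
  have hb : BddAbove {k : ℕ | ∃ W : Finset V, W.card = k ∧ G.CliqueFreeOn (W : Set V) s} := by
    refine ⟨Fintype.card V, ?_⟩
    rintro k ⟨W, rfl, -⟩
    exact W.card_le_univ
  refine ⟨Nat.sSup_mem ⟨0, ∅, rfl, ?_⟩ hb, fun k hk => le_csSup hb hk⟩
  intro t ht hc
  have h0 : t = ∅ := by simpa using ht
  have h1 := hc.card_eq
  rw [h0, Finset.card_empty] at h1
  omega

/-- The Erdős–Rogers function `f_{s,t}(n)`: the minimum of `α_s(G)` over all `K_t`-free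
graphs `G` of order `n`. -/
noncomputable def erdosRogers (s t n : ℕ) : ℕ :=
  sInf {k : ℕ | ∃ G : SimpleGraph (Fin n), G.CliqueFree t ∧ sIndepNum G s = k}

/-- For `t ≥ 2` the infimum in `erdosRogers` is a minimum. -/
theorem isLeast_erdosRogers (s n : ℕ) {t : ℕ} (ht : 2 ≤ t) :
    IsLeast {k : ℕ | ∃ G : SimpleGraph (Fin n), G.CliqueFree t ∧ sIndepNum G s = k}
      (erdosRogers s t n) :=
  ⟨Nat.sInf_mem ⟨_, ⊥, SimpleGraph.cliqueFree_bot ht, rfl⟩, fun _ hk => Nat.sInf_le hk⟩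

/-! Take the affine plane over `ZMod q` with `k` parallel classes, `k` a large constant times `log
q`. Each point picks a random label in `Fin R` for every class, which cuts every line into `R`
parts. Each incidence (point, class) gets a random colour out of `s`; inside a part, points of
different colours are joined unless the pair is bad, that is, closes a triangle with sides in three
classes. Hence a clique lives in a single part, where its colours are distinct, so it has at most
`s` vertices (`partGraph_cliqueFree`). Deleting bad pairs must not destroy too many copies of `K_s`.
A Chernoff and union bound over the labels shows that any `M` points of a part, `M` polylogarithmic,
contain `s` points without a bad pair (`exists_hasGoodSubsets`). So a set of `w ≥ 2RqM` points
carries about `wk / 2s` disjoint such groups of incidences (`exists_disjoint_goodGroups`). Each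
becomes rainbow, hence a `K_s`, with probability at least `s^(-s)`, independently; the factor `k`
beats the at most `q^(2w)` choices of the set (`exists_graph_of_hasGoodSubsets`). This gives `w` of
order `(log n)^7 √n`, and `7 ≤ 4s²`. -/

open Finset

/-! ### Counting tools: exponential moments, Turán, rainbow sets. -/

/-- Exponential moment bound: if `g : V → X` is uniformly random and the events `H v (g v)` have
total probability at most `P`, then at least `T` of them occur with probability at most
`exp (2 * P - T)`. -/
theorem card_filter_le_exp {V X : Type*} [Fintype V] [DecidableEq V] [Fintype X] [Nonempty X]
    (H : V → X → Prop) [∀ v h, Decidable (H v h)] (T : ℕ) (P : ℝ)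
    (hP : ∑ v, (#{h | H v h} : ℝ) ≤ P * Fintype.card X) :
    (#{g : V → X | T ≤ #{v | H v (g v)}} : ℝ) ≤
      (Fintype.card X : ℝ) ^ Fintype.card V * Real.exp (2 * P - T) := by
  have hX : (0 : ℝ) < Fintype.card X := by exact_mod_cast Fintype.card_pos
  have h1 : (#{g : V → X | T ≤ #{v | H v (g v)}} : ℝ) * Real.exp T ≤
      ∑ g : V → X, ∏ v, (if H v (g v) then Real.exp 1 else 1) := by
    rw [← nsmul_eq_mul, ← Finset.sum_const]
    refine (Finset.sum_le_sum (fun g hg => ?_)).trans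
      (Finset.sum_le_sum_of_subset_of_nonneg (Finset.subset_univ _) (fun g _ _ =>
        Finset.prod_nonneg fun v _ => ?_))
    · rw [Finset.prod_ite, Finset.prod_const, Finset.prod_const_one, mul_one, ← Real.exp_nat_mul,
        mul_one]
      have := (Finset.mem_filter.1 hg).2
      exact Real.exp_le_exp.2 (by exact_mod_cast this)
    · split_ifs <;> positivity
  -- Independence of the coordinates of `g`: the moment factorises.
  have h2 : ∑ g : V → X, ∏ v, (if H v (g v) then Real.exp 1 else 1) =
      ∏ v : V, ∑ h : X, (if H v h then Real.exp 1 else 1) := by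
    rw [Finset.prod_univ_sum, Fintype.piFinset_univ]
  have h3 : ∀ v : V, ∑ h : X, (if H v h then Real.exp 1 else 1) ≤
      (Fintype.card X : ℝ) * Real.exp (2 * ((#{h | H v h} : ℝ) / Fintype.card X)) := by
    intro v
    have e1 : ∑ h : X, (if H v h then Real.exp 1 else 1) =
        Fintype.card X + (Real.exp 1 - 1) * #{h | H v h} := by
      have : ∀ h : X, (if H v h then Real.exp 1 else 1) =
          1 + (if H v h then (Real.exp 1 - 1) else 0) := by
        intro h; split_ifs <;> ring
      rw [Finset.sum_congr rfl fun h _ => this h, Finset.sum_add_distrib, ← Finset.sum_filter]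
      simp only [sum_const, card_univ, nsmul_eq_mul, mul_one]
      ring
    rw [e1]
    have e2 := Real.add_one_le_exp (2 * ((#{h | H v h} : ℝ) / Fintype.card X))
    have e3 : Real.exp 1 - 1 ≤ 2 := by linarith [Real.exp_one_lt_d9]
    calc (Fintype.card X : ℝ) + (Real.exp 1 - 1) * #{h | H v h}
        ≤ Fintype.card X + 2 * #{h | H v h} := by gcongr
      _ = Fintype.card X * (2 * ((#{h | H v h} : ℝ) / Fintype.card X) + 1) := by
          field_simp; ring
      _ ≤ _ := by gcongr
  have h4 : ∏ v : V, ∑ h : X, (if H v h then Real.exp 1 else 1) ≤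
      (Fintype.card X : ℝ) ^ Fintype.card V * Real.exp (2 * P) := by
    refine (Finset.prod_le_prod (fun v _ => Finset.sum_nonneg fun h _ => ?_)
      fun v _ => h3 v).trans ?_
    · split_ifs <;> positivity
    · rw [Finset.prod_mul_distrib, Finset.prod_const, Finset.card_univ, ← Real.exp_sum,
        ← Finset.mul_sum, ← Finset.sum_div]
      gcongr
      rwa [div_le_iff₀ hX]
  rw [Real.exp_sub, ← mul_div_assoc, le_div_iff₀ (Real.exp_pos _)]
  exact h1.trans (h2.trans_le h4)

/-- The number of functions with two prescribed values. -/
theorem card_filter_two_values {k R : ℕ} {i j : Fin k} (hij : i ≠ j) (a b : Fin R) :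
    #{h : Fin k → Fin R | h i = a ∧ h j = b} * R ^ 2 = R ^ k := by
  have : ({h : Fin k → Fin R | h i = a ∧ h j = b} : Finset _) =
      Fintype.piFinset (fun l => if l = i then {a} else if l = j then {b} else univ) := by
    ext h
    simp only [mem_filter, mem_univ, true_and, Fintype.mem_piFinset]
    constructor
    · rintro ⟨rfl, rfl⟩ l
      split_ifs with h1 h2 <;> simp_all
    · intro hl
      refine ⟨by simpa using hl i, ?_⟩
      have := hl j
      rw [if_neg hij.symm] at this
      simpa using this
  rw [this, Fintype.card_piFinset]
  have hc : ∀ l : Fin k, #(if l = i then {a} else if l = j then {b} else (univ : Finset (Fin R))) =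
      (if l = i then 1 else if l = j then 1 else R) := by
    intro l; split_ifs <;> simp
  rw [Finset.prod_congr rfl fun l _ => hc l,
    ← Finset.mul_prod_erase _ _ (mem_univ i), ← Finset.mul_prod_erase _ _
      (mem_erase.2 ⟨hij.symm, mem_univ j⟩)]
  rw [if_pos rfl, if_neg hij.symm, if_pos rfl, Finset.prod_congr rfl (g := fun _ => R),
    Finset.prod_const, card_erase_of_mem (mem_erase.2 ⟨hij.symm, mem_univ j⟩),
    card_erase_of_mem (mem_univ i), card_univ, Fintype.card_fin, one_mul, one_mul, ← pow_add]
  · congr 1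
    have h1 := i.2
    have h2 := j.2
    have h3 : i.1 ≠ j.1 := fun h => hij (Fin.ext h)
    omega
  · intro l hl
    simp only [mem_erase] at hl
    rw [if_neg hl.2.1, if_neg hl.1]

/-- A consequence of Turán's theorem: a symmetric relation on `M` points without an independent set
of size `s` has at least `M ^ 2 / (4 * s)` ordered pairs. -/
theorem sq_le_card_pairs {M s : ℕ} (hs : 2 ≤ s) (hM : 2 * s ≤ M) (B : Fin M → Fin M → Prop)
    [∀ x y, Decidable (B x y)] (hB : ∀ x y, B x y → B y x)
    (h : ∀ I : Finset (Fin M), #I = s → ∃ x ∈ I, ∃ y ∈ I, x ≠ y ∧ B x y) :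
    M ^ 2 ≤ 4 * s * #{p : Fin M × Fin M | p.1 ≠ p.2 ∧ B p.1 p.2} := by
  classical
  let G : SimpleGraph (Fin M) :=
    { Adj := fun x y => x ≠ y ∧ ¬ B x y
      symm := ⟨fun x y hxy => ⟨hxy.1.symm, fun hb => hxy.2 (hB _ _ hb)⟩⟩
      loopless := ⟨fun x hx => hx.1 rfl⟩ }
  obtain ⟨r, rfl⟩ : ∃ r, s = r + 1 := ⟨s - 1, by omega⟩
  have hG : G.CliqueFree (r + 1) := by
    intro I hI
    obtain ⟨x, hx, y, hy, hxy, hb⟩ := h I hI.card_eq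
    exact (hI.isClique hx hy hxy).2 hb
  have hr : 0 < r := by omega
  have h1 : 2 * r * #G.edgeFinset ≤ (r - 1) * M ^ 2 := by
    refine le_trans ?_ (SimpleGraph.mul_card_edgeFinset_turanGraph_le (n := M) (r := r))
    exact Nat.mul_le_mul_left _ ((SimpleGraph.isTuranMaximal_turanGraph hr).2 hG)
  have h2 : #{p : Fin M × Fin M | G.Adj p.1 p.2} = 2 * #G.edgeFinset := by
    rw [← SimpleGraph.sum_degrees_eq_twice_card_edges, Finset.card_filter, ← Finset.univ_product_univ,
      Finset.sum_product]
    refine Finset.sum_congr rfl fun x _ => ?_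
    rw [← Finset.card_filter, ← SimpleGraph.card_neighborFinset_eq_degree,
      SimpleGraph.neighborFinset_eq_filter]
  have h3 : M ^ 2 = #{p : Fin M × Fin M | p.1 ≠ p.2 ∧ B p.1 p.2} +
      #{p : Fin M × Fin M | G.Adj p.1 p.2} + M := by
    have e0 : #{p : Fin M × Fin M | p.1 = p.2} = M := by
      rw [Finset.card_filter, ← Finset.univ_product_univ, Finset.sum_product]
      simp
    have e1 : Fintype.card (Fin M × Fin M) = M ^ 2 := by simp [sq]
    have e2 := Finset.card_filter_add_card_filter_not (s := (univ : Finset (Fin M × Fin M)))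
      (fun p => p.1 = p.2)
    have e3 := Finset.card_filter_add_card_filter_not
      (s := (univ : Finset (Fin M × Fin M)).filter (fun p => ¬ p.1 = p.2)) (fun p => B p.1 p.2)
    rw [Finset.filter_filter, Finset.filter_filter] at e3
    rw [card_univ, e1, e0] at e2
    change _ + #{p : Fin M × Fin M | p.1 ≠ p.2 ∧ ¬ B p.1 p.2} = _ at e3
    change M ^ 2 = _ + #{p : Fin M × Fin M | p.1 ≠ p.2 ∧ ¬ B p.1 p.2} + M
    simp only [ne_eq] at *
    omega
  obtain ⟨t, rfl⟩ : ∃ t, r = t + 1 := ⟨r - 1, by omega⟩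
  rw [h2] at h3
  simp only [Nat.add_sub_cancel] at h1
  set b := #{p : Fin M × Fin M | p.1 ≠ p.2 ∧ B p.1 p.2}
  -- With `r = s - 1`, Turán leaves at least `M² / r - M` ordered pairs, and `M ≥ 2s` absorbs the
  -- diagonal term `M`.
  nlinarith [Nat.zero_le b]

open scoped Classical in
/-- If a set `A` of colourings is closed under recolouring `G`, then at most a proportion
`1 - s ^ (-s)` of it fails to be injective on `G`. -/
theorem card_filter_not_injOn_le {Y : Type*} [Fintype Y] {s : ℕ}
    (A : Finset (Y → Fin s)) (G : Finset Y) (hG : #G = s)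
    (hA : ∀ c ∈ A, ∀ c' : Y → Fin s, (∀ y ∉ G, c' y = c y) → c' ∈ A) :
    (#{c ∈ A | ¬ Set.InjOn c G} : ℝ) ≤ (1 - ((s : ℝ) ^ s)⁻¹) * #A := by
  classical
  rcases Nat.eq_zero_or_pos s with rfl | hs
  · have : G = ∅ := by simpa using hG
    subst this
    simp
  let φ : G ≃ Fin s := G.equivFinOfCardEq hG
  -- Overwriting `c` on `G` by a fixed bijection forgets only the `s` colours on `G`, so fibres have
  -- size at most `s ^ s`.
  let ov : (Y → Fin s) → (Y → Fin s) := fun c y => if h : y ∈ G then φ ⟨y, h⟩ else c y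
  have hov : ∀ c ∈ A, ov c ∈ ({c ∈ A | Set.InjOn c G} : Finset _) := by
    intro c hc
    refine mem_filter.2 ⟨hA c hc _ fun y hy => by simp [ov, hy], ?_⟩
    intro x hx y hy hxy
    have hx' : x ∈ G := hx
    have hy' : y ∈ G := hy
    simp only [ov, hx', hy', dif_pos] at hxy
    simpa using φ.injective hxy
  have h1 := Finset.card_le_mul_card_image_of_maps_to hov (s ^ s) (by
    intro b _
    have : #(univ : Finset (G → Fin s)) = s ^ s := by
      simp [hG]
    rw [← this]
    refine Finset.card_le_card_of_injOn (fun c y => c y) (fun _ _ => by simp) ?_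
    intro c hc c' hc' hcc
    have e1 := (mem_filter.1 hc).2
    have e2 := (mem_filter.1 hc').2
    funext y
    by_cases hy : y ∈ G
    · exact congrFun hcc ⟨y, hy⟩
    · have := congrFun (e1.trans e2.symm) y
      simpa [ov, hy] using this)
  have h2 := Finset.card_filter_add_card_filter_not (s := A) (fun c => Set.InjOn c (G : Set Y))
  have h1' : (#A : ℝ) ≤ (s : ℝ) ^ s * #{c ∈ A | Set.InjOn c G} := by exact_mod_cast h1
  have h2' : (#{c ∈ A | Set.InjOn c G} : ℝ) + #{c ∈ A | ¬ Set.InjOn c G} = #A := by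
    exact_mod_cast h2
  have hpos : (0 : ℝ) < (s : ℝ) ^ s := by positivity
  have h3 : ((s : ℝ) ^ s)⁻¹ * #A ≤ #{c ∈ A | Set.InjOn c G} := by
    rwa [inv_mul_le_iff₀ hpos]
  linarith

open scoped Classical in
/-- Few colourings are non-injective on every member of a disjoint family of `s`-sets. -/
theorem card_filter_forall_not_injOn_le {Y : Type*} [Fintype Y] {s : ℕ}
    (𝓕 : Finset (Finset Y)) (hs : ∀ G ∈ 𝓕, #G = s)
    (hd : (𝓕 : Set (Finset Y)).PairwiseDisjoint id) :
    (#{c : Y → Fin s | ∀ G ∈ 𝓕, ¬ Set.InjOn c G} : ℝ) ≤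
      (1 - ((s : ℝ) ^ s)⁻¹) ^ #𝓕 * (s : ℝ) ^ Fintype.card Y := by
  classical
  have hs1 : (0 : ℝ) ≤ 1 - ((s : ℝ) ^ s)⁻¹ := by
    rw [sub_nonneg]
    apply inv_le_one_of_one_le₀
    exact_mod_cast Nat.pow_self_pos
  induction 𝓕 using Finset.induction_on with
  | empty => simp
  | insert G 𝓕 hG ih =>
    have e : ({c : Y → Fin s | ∀ G' ∈ insert G 𝓕, ¬ Set.InjOn c G'} : Finset _) =
        {c ∈ ({c : Y → Fin s | ∀ G' ∈ 𝓕, ¬ Set.InjOn c G'} : Finset _) | ¬ Set.InjOn c G} := by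
      ext c
      simp only [mem_filter, mem_univ, true_and, Finset.forall_mem_insert]
      exact and_comm
    -- By disjointness, failing on the sets of `𝓕` does not depend on the colours on `G`.
    have hA := card_filter_not_injOn_le
      ({c : Y → Fin s | ∀ G' ∈ 𝓕, ¬ Set.InjOn c G'} : Finset _) G (hs G (mem_insert_self _ _))
      (by
        intro c hc c' hcc
        simp only [mem_filter, mem_univ, true_and] at hc ⊢
        intro G' hG' hinj
        refine hc G' hG' (hinj.congr ?_)
        intro y hy
        refine hcc y fun hyG => ?_
        have hne : G ≠ G' := fun h => hG (h ▸ hG')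
        have := hd (mem_coe.2 (mem_insert_self G 𝓕)) (mem_coe.2 (mem_insert_of_mem hG')) hne
        exact Finset.disjoint_left.1 this hyG hy)
    have ih' := ih (fun G' h => hs G' (mem_insert_of_mem h))
      (hd.subset (by simp))
    rw [card_insert_of_notMem hG, pow_succ', e]
    calc _ ≤ _ := hA
      _ ≤ (1 - ((s : ℝ) ^ s)⁻¹) * ((1 - ((s : ℝ) ^ s)⁻¹) ^ #𝓕 * (s : ℝ) ^ Fintype.card Y) := by
        gcongr
      _ = _ := by ring

/-! ### The random graph on a linear space. -/

section Construction

variable {V F : Type*} {k R s : ℕ}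

/-- `u` and `v` lie on a common line of the `j`-th parallel class, and in the same part of the
partition of that line described by `g`. -/
def OnPart (e : Fin k → V → F) (g : V → Fin k → Fin R) (j : Fin k) (u v : V) : Prop :=
  e j u = e j v ∧ g u j = g v j

/-- A pair of points in a common part of the `j`-th class is bad if it closes a triangle whose
other two sides come from two further classes. -/
def IsBad (e : Fin k → V → F) (g : V → Fin k → Fin R) (j : Fin k) (x y : V) : Prop :=
  ∃ v j₁ j₂, j₁ ≠ j ∧ j₂ ≠ j ∧ j₁ ≠ j₂ ∧ OnPart e g j₁ v x ∧ OnPart e g j₂ v y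

theorem OnPart.symm {e : Fin k → V → F} {g : V → Fin k → Fin R} {j : Fin k} {u v : V}
    (h : OnPart e g j u v) : OnPart e g j v u := ⟨h.1.symm, h.2.symm⟩

theorem OnPart.trans {e : Fin k → V → F} {g : V → Fin k → Fin R} {j : Fin k} {u v w : V}
    (h : OnPart e g j u v) (h' : OnPart e g j v w) : OnPart e g j u w :=
  ⟨h.1.trans h'.1, h.2.trans h'.2⟩

theorem IsBad.symm {e : Fin k → V → F} {g : V → Fin k → Fin R} {j : Fin k} {x y : V}
    (h : IsBad e g j x y) : IsBad e g j y x := by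
  obtain ⟨v, j₁, j₂, h₁, h₂, h₃, h₄, h₅⟩ := h
  exact ⟨v, j₂, j₁, h₂, h₁, h₃.symm, h₅, h₄⟩

/-- Within each part, join the points of different colours that do not form a bad pair. -/
def partGraph (e : Fin k → V → F) (g : V → Fin k → Fin R) (c : V × Fin k → Fin s) :
    SimpleGraph V where
  Adj x y := ∃ j, OnPart e g j x y ∧ c (x, j) ≠ c (y, j) ∧ ¬ IsBad e g j x y
  symm := ⟨fun _ _ ⟨j, h₁, h₂, h₃⟩ => ⟨j, h₁.symm, h₂.symm, fun h => h₃ h.symm⟩⟩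
  loopless := ⟨fun _ ⟨_, _, h, _⟩ => h rfl⟩

/-- Distinct points lie on at most one common line. -/
def IsLinearSpace (e : Fin k → V → F) : Prop :=
  ∀ ⦃i j : Fin k⦄ ⦃u v : V⦄, i ≠ j → e i u = e i v → e j u = e j v → u = v

/-- An edge `xy` of class `j` forces every other vertex `v` of the clique into the same part: if two
sides of `vxy` share a class, all three do by linearity, and otherwise `xy` would be bad. -/
theorem partGraph_cliqueFree {e : Fin k → V → F} (he : IsLinearSpace e) (hs : 2 ≤ s)
    (g : V → Fin k → Fin R) (c : V × Fin k → Fin s) :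
    (partGraph e g c).CliqueFree (s + 1) := by
  classical
  intro I hI
  have huniq : ∀ {i j : Fin k} {u v : V}, u ≠ v → OnPart e g i u v → OnPart e g j u v → i = j := by
    intro i j u v huv h₁ h₂
    by_contra hij
    exact huv (he hij h₁.1 h₂.1)
  obtain ⟨x, hx, y, hy, hxy⟩ := Finset.one_lt_card.1 (by rw [hI.card_eq]; omega : 1 < #I)
  obtain ⟨j, hj, -, hbad⟩ := hI.isClique hx hy hxy
  have hall : ∀ v ∈ I, OnPart e g j v x := by
    intro v hv
    rcases eq_or_ne v x with rfl | hvx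
    · exact ⟨rfl, rfl⟩
    rcases eq_or_ne v y with rfl | hvy
    · exact hj.symm
    obtain ⟨j₁, h₁, -, -⟩ := hI.isClique hv hx hvx
    obtain ⟨j₂, h₂, -, -⟩ := hI.isClique hv hy hvy
    rcases eq_or_ne j₁ j with rfl | hj₁
    · exact h₁
    rcases eq_or_ne j₂ j with rfl | hj₂
    · exact h₂.trans hj.symm
    rcases eq_or_ne j₁ j₂ with rfl | hj₁₂
    · exact absurd (huniq hxy (h₁.symm.trans h₂) hj) hj₁
    · exact absurd ⟨v, j₁, j₂, hj₁, hj₂, hj₁₂, h₁, h₂⟩ hbad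
  have hinj : Set.InjOn (fun v => c (v, j)) I := by
    intro u hu v hv huv
    by_contra hne
    obtain ⟨i, hi, hc, -⟩ := hI.isClique hu hv hne
    obtain rfl := huniq hne hi ((hall u hu).trans (hall v hv).symm)
    exact hc huv
  have := Finset.card_le_card_of_injOn (t := univ) (fun v => c (v, j)) (fun _ _ => mem_univ _) hinj
  rw [hI.card_eq, card_univ, Fintype.card_fin] at this
  omega

/-! ### Few bad pairs: choosing the labels. -/

/-- Any `M` points in a common part contain `s` points without a bad pair. -/
def HasGoodSubsets (e : Fin k → V → F) (g : V → Fin k → Fin R) (M s : ℕ) : Prop :=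
  ∀ j, ∀ S : Finset V, #S = M → (∀ u ∈ S, ∀ v ∈ S, OnPart e g j u v) →
    ∃ I ⊆ S, #I = s ∧ ∀ u ∈ I, ∀ v ∈ I, u ≠ v → ¬ IsBad e g j u v

/-- The vertex `v` with choices `h` is joined to two members of the sequence `σ` with choices `γ`
through different classes. -/
def Hits {M : ℕ} (e : Fin k → V → F) (σ : Fin M → V) (γ : Fin M → Fin k → Fin R) (v : V)
    (h : Fin k → Fin R) : Prop :=
  ∃ i i' j₁ j₂, j₁ ≠ j₂ ∧ e j₁ v = e j₁ (σ i) ∧ e j₂ v = e j₂ (σ i') ∧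
    h j₁ = γ i j₁ ∧ h j₂ = γ i' j₂

-- Two lines of different classes meet in at most one point, so each choice of `(i, i', j₁, j₂)`
-- concerns a single `v`, whose two prescribed labels have probability `1 / R²`.
open scoped Classical in
theorem sum_card_hits_le [Fintype V] {M : ℕ} {e : Fin k → V → F} (he : IsLinearSpace e) (hR : 0 < R)
    (σ : Fin M → V) (γ : Fin M → Fin k → Fin R) :
    ∑ v, (#{h | Hits e σ γ v h} : ℝ) ≤
      ((M : ℝ) ^ 2 * k ^ 2 / R ^ 2) * Fintype.card (Fin k → Fin R) := by
  let Q : Finset (Fin M × Fin M × Fin k × Fin k) := univ.filter fun t => t.2.2.1 ≠ t.2.2.2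
  let cand : V → (Fin M × Fin M × Fin k × Fin k) → Prop := fun v t =>
    e t.2.2.1 v = e t.2.2.1 (σ t.1) ∧ e t.2.2.2 v = e t.2.2.2 (σ t.2.1)
  have hRR : (0 : ℝ) < (R : ℝ) ^ 2 := by positivity
  have h1 : ∀ v, (#{h | Hits e σ γ v h} : ℝ) ≤
      ∑ t ∈ Q, if cand v t then (R : ℝ) ^ k / R ^ 2 else 0 := by
    intro v
    have hsub : ({h | Hits e σ γ v h} : Finset (Fin k → Fin R)) ⊆
        (Q.filter (cand v)).biUnion fun t =>
          {h | h t.2.2.1 = γ t.1 t.2.2.1 ∧ h t.2.2.2 = γ t.2.1 t.2.2.2} := by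
      intro h hh
      obtain ⟨i, i', j₁, j₂, h₁, h₂, h₃, h₄, h₅⟩ := (mem_filter.1 hh).2
      simp only [mem_biUnion, mem_filter, mem_univ, true_and, Q]
      exact ⟨(i, i', j₁, j₂), ⟨h₁, h₂, h₃⟩, h₄, h₅⟩
    have hcard := (card_le_card hsub).trans card_biUnion_le
    rw [← Finset.sum_filter]
    calc (#{h | Hits e σ γ v h} : ℝ) ≤ ((∑ t ∈ Q.filter (cand v),
          #{h : Fin k → Fin R | h t.2.2.1 = γ t.1 t.2.2.1 ∧ h t.2.2.2 = γ t.2.1 t.2.2.2} : ℕ) : ℝ) := by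
          exact_mod_cast hcard
      _ = _ := by
          push_cast
          refine Finset.sum_congr rfl fun t ht => ?_
          have hne : t.2.2.1 ≠ t.2.2.2 := (mem_filter.1 (mem_filter.1 ht).1).2
          rw [eq_div_iff hRR.ne']
          exact_mod_cast card_filter_two_values hne _ _
  calc ∑ v, (#{h | Hits e σ γ v h} : ℝ)
      ≤ ∑ v, ∑ t ∈ Q, if cand v t then (R : ℝ) ^ k / R ^ 2 else 0 :=
        Finset.sum_le_sum fun v _ => h1 v
    _ = ∑ t ∈ Q, (#{v | cand v t} : ℝ) * ((R : ℝ) ^ k / R ^ 2) := by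
        rw [Finset.sum_comm]
        refine Finset.sum_congr rfl fun t _ => ?_
        rw [← Finset.sum_filter, Finset.sum_const, nsmul_eq_mul]
    _ ≤ ∑ t ∈ Q, 1 * ((R : ℝ) ^ k / R ^ 2) := by
        refine Finset.sum_le_sum fun t ht => ?_
        have hne : t.2.2.1 ≠ t.2.2.2 := (mem_filter.1 ht).2
        gcongr
        have : #{v | cand v t} ≤ 1 := by
          refine Finset.card_le_one.2 fun u hu v hv => ?_
          have h₁ := (mem_filter.1 hu).2
          have h₂ := (mem_filter.1 hv).2
          exact he hne (h₁.1.trans h₂.1.symm) (h₁.2.trans h₂.2.symm)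
        exact_mod_cast this
    _ ≤ (M : ℝ) ^ 2 * k ^ 2 * ((R : ℝ) ^ k / R ^ 2) := by
        rw [Finset.sum_const, nsmul_eq_mul, one_mul]
        gcongr
        have : #Q ≤ M ^ 2 * k ^ 2 := by
          refine (card_le_univ _).trans (le_of_eq ?_)
          simp only [Fintype.card_prod, Fintype.card_fin]
          ring
        exact_mod_cast this
    _ = _ := by
        simp only [Fintype.card_fun, Fintype.card_fin]
        push_cast
        ring

-- Turán gives `M² / (4s)` bad pairs. A witness `v` with its classes `j₁, j₂` determines the pair,
-- since a line of another class meets the line of `σ` at most once; so each `v` serves at most `k²`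
-- pairs.
open scoped Classical in
theorem le_card_hits [Fintype V] {M T : ℕ} {e : Fin k → V → F} (he : IsLinearSpace e)
    (hs : 2 ≤ s) (hM : 2 * s ≤ M) (hk : 0 < k) (hT : T * k ^ 2 * (4 * s) ≤ M ^ 2)
    (g : V → Fin k → Fin R) (j : Fin k) (σ : Fin M → V) (hσ : Function.Injective σ)
    (hpart : ∀ i i', OnPart e g j (σ i) (σ i'))
    (hI : ∀ I : Finset (Fin M), #I = s → ∃ x ∈ I, ∃ y ∈ I, x ≠ y ∧ IsBad e g j (σ x) (σ y)) :
    T ≤ #{v | Hits e σ (fun i => g (σ i)) v (g v)} := by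
  have h1 := sq_le_card_pairs hs hM (fun x y => IsBad e g j (σ x) (σ y)) (fun _ _ h => h.symm) hI
  set A : Finset (Fin M × Fin M) := {p | p.1 ≠ p.2 ∧ IsBad e g j (σ p.1) (σ p.2)} with hA
  have hex : ∀ p : Fin M × Fin M, ∃ t : V × Fin k × Fin k, p ∈ A →
      t.2.1 ≠ j ∧ t.2.2 ≠ j ∧ t.2.1 ≠ t.2.2 ∧
      OnPart e g t.2.1 t.1 (σ p.1) ∧ OnPart e g t.2.2 t.1 (σ p.2) := by
    intro p
    by_cases hp : p ∈ A
    · obtain ⟨v, j₁, j₂, h⟩ := (mem_filter.1 hp).2.2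
      exact ⟨(v, j₁, j₂), fun _ => h⟩
    · exact ⟨(σ p.1, j, j), fun h => absurd h hp⟩
  choose w hw using hex
  have h2 : #A ≤ k ^ 2 * #{v | Hits e σ (fun i => g (σ i)) v (g v)} := by
    refine Finset.card_le_mul_card_image_of_maps_to (f := fun p => (w p).1) ?_ _ ?_
    · intro p hp
      obtain ⟨-, -, h₃, h₄, h₅⟩ := hw p hp
      exact mem_filter.2 ⟨mem_univ _, p.1, p.2, _, _, h₃, h₄.1, h₅.1, h₄.2, h₅.2⟩
    · intro v _
      have hc : #(univ : Finset (Fin k × Fin k)) = k ^ 2 := by simp [sq]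
      rw [← hc]
      refine Finset.card_le_card_of_injOn (fun p => (w p).2) (fun _ _ => mem_coe.2 (mem_univ _)) ?_
      intro p hp p' hp' hpp
      obtain ⟨hpA, hpv⟩ := mem_filter.1 hp
      obtain ⟨hpA', hpv'⟩ := mem_filter.1 hp'
      obtain ⟨h₁, h₂, -, h₄, h₅⟩ := hw p hpA
      obtain ⟨-, -, -, h₄', h₅'⟩ := hw p' hpA'
      simp only at hpp
      rw [← hpp, hpv', ← hpv] at h₄' h₅'
      refine Prod.ext (hσ ?_) (hσ ?_)
      · exact he h₁ (h₄.symm.trans h₄').1 (hpart _ _).1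
      · exact he h₂ (h₅.symm.trans h₅').1 (hpart _ _).1
  have h3 : T * (k ^ 2 * (4 * s)) ≤
      #{v | Hits e σ (fun i => g (σ i)) v (g v)} * (k ^ 2 * (4 * s)) := by
    calc T * (k ^ 2 * (4 * s)) = T * k ^ 2 * (4 * s) := by ring
      _ ≤ M ^ 2 := hT
      _ ≤ 4 * s * #A := h1
      _ ≤ 4 * s * (k ^ 2 * _) := Nat.mul_le_mul_left _ h2
      _ = _ := by ring
  exact Nat.le_of_mul_le_mul_right h3 (by positivity)

theorem exists_hasGoodSubsets [Fintype V] {M T : ℕ} {e : Fin k → V → F} (he : IsLinearSpace e)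
    (hs : 2 ≤ s) (hM : 2 * s ≤ M) (hk : 0 < k) (hR : 0 < R) (hT : T * k ^ 2 * (4 * s) ≤ M ^ 2)
    (hprob : ((Fintype.card V : ℝ) * R ^ k) ^ M *
      Real.exp (2 * ((M : ℝ) ^ 2 * k ^ 2 / R ^ 2) - T) < 1) :
    ∃ g : V → Fin k → Fin R, HasGoodSubsets e g M s := by
  classical
  have : Nonempty (Fin R) := ⟨⟨0, hR⟩⟩
  -- The labels along `σ` are guessed in advance as part of the union bound, so the events for
  -- different `v` stay independent without conditioning.
  let 𝓑 : (Fin M → V) × (Fin M → Fin k → Fin R) → Finset (V → Fin k → Fin R) := fun t =>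
    {g | T ≤ #{v | Hits e t.1 t.2 v (g v)}}
  have hB : ∀ t, (#(𝓑 t) : ℝ) ≤ (Fintype.card (Fin k → Fin R) : ℝ) ^ Fintype.card V *
      Real.exp (2 * ((M : ℝ) ^ 2 * k ^ 2 / R ^ 2) - T) := fun t =>
    card_filter_le_exp (Hits e t.1 t.2) T _ (sum_card_hits_le he hR t.1 t.2)
  have hlt : #(univ.biUnion 𝓑) < #(univ : Finset (V → Fin k → Fin R)) := by
    have h1 : (#(univ.biUnion 𝓑) : ℝ) ≤ ((Fintype.card V : ℝ) * R ^ k) ^ M *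
        ((Fintype.card (Fin k → Fin R) : ℝ) ^ Fintype.card V *
          Real.exp (2 * ((M : ℝ) ^ 2 * k ^ 2 / R ^ 2) - T)) := by
      calc (#(univ.biUnion 𝓑) : ℝ) ≤ ∑ t, (#(𝓑 t) : ℝ) := by exact_mod_cast card_biUnion_le
        _ ≤ ∑ _t : (Fin M → V) × (Fin M → Fin k → Fin R), _ := Finset.sum_le_sum fun t _ => hB t
        _ = _ := by
          rw [Finset.sum_const, nsmul_eq_mul, card_univ]
          simp only [Fintype.card_prod, Fintype.card_fun, Fintype.card_fin]
          push_cast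
          rw [mul_pow]
    have hpos : (0 : ℝ) < (Fintype.card (Fin k → Fin R) : ℝ) ^ Fintype.card V := by
      have : 0 < Fintype.card (Fin k → Fin R) := Fintype.card_pos
      positivity
    have h2 : (#(univ.biUnion 𝓑) : ℝ) < (Fintype.card (Fin k → Fin R) : ℝ) ^ Fintype.card V := by
      refine h1.trans_lt ?_
      rw [mul_left_comm]
      exact mul_lt_of_lt_one_right hpos hprob
    rw [card_univ, Fintype.card_fun]
    exact_mod_cast h2
  obtain ⟨g, -, hg⟩ := Finset.exists_mem_notMem_of_card_lt_card hlt
  refine ⟨g, fun j S hS hpart => ?_⟩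
  by_contra! hcon
  let σ : Fin M → V := fun i => ((S.equivFinOfCardEq hS).symm i : V)
  have hσ : Function.Injective σ :=
    Subtype.val_injective.comp (S.equivFinOfCardEq hS).symm.injective
  have hσS : ∀ i, σ i ∈ S := fun i => ((S.equivFinOfCardEq hS).symm i).2
  refine hg (mem_biUnion.2 ⟨(σ, fun i => g (σ i)), mem_univ _, mem_filter.2 ⟨mem_univ _, ?_⟩⟩)
  refine le_card_hits he hs hM hk hT g j σ hσ (fun i i' => hpart _ (hσS i) _ (hσS i')) ?_
  intro I hI
  obtain ⟨u, hu, v, hv, huv, hb⟩ := hcon (I.image σ)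
    (fun x hx => by obtain ⟨i, -, rfl⟩ := mem_image.1 hx; exact hσS i)
    (by rw [card_image_of_injective _ hσ, hI])
  obtain ⟨x, hx, rfl⟩ := mem_image.1 hu
  obtain ⟨y, hy, rfl⟩ := mem_image.1 hv
  exact ⟨x, hx, y, hy, fun h => huv (h ▸ rfl), hb⟩

/-! ### Many disjoint good groups: choosing the colours. -/

/-- A set of `s` incidences of one class whose points form a set without bad pairs in one part. -/
def IsGoodGroup (e : Fin k → V → F) (g : V → Fin k → Fin R) (s : ℕ) (G : Finset (V × Fin k)) :
    Prop :=
  #G = s ∧ ∀ p ∈ G, ∀ p' ∈ G, p.2 = p'.2 ∧ OnPart e g p.2 p.1 p'.1 ∧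
    (p ≠ p' → ¬ IsBad e g p.2 p.1 p'.1)

/-- For a largest disjoint family, fewer than `M + 1` uncovered incidences lie in each of the `k R
|F|` parts, as otherwise another group fits. By `hW` at least half of the incidences are covered. -/
theorem exists_disjoint_goodGroups [Fintype F] {M : ℕ} {e : Fin k → V → F}
    {g : V → Fin k → Fin R} (hg : HasGoodSubsets e g M s) (hs : 0 < s)
    (W : Finset V) (hW : 2 * (R * Fintype.card F * M) ≤ #W) :
    ∃ 𝓕 : Finset (Finset (V × Fin k)), (∀ G ∈ 𝓕, IsGoodGroup e g s G ∧ G ⊆ W ×ˢ univ) ∧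
      (𝓕 : Set (Finset (V × Fin k))).PairwiseDisjoint id ∧ #W * k ≤ 2 * (s * #𝓕) := by
  classical
  let X : Finset (V × Fin k) := W ×ˢ univ
  let 𝓢 : Finset (Finset (Finset (V × Fin k))) := X.powerset.powerset.filter fun 𝓕 =>
    (∀ G ∈ 𝓕, IsGoodGroup e g s G) ∧ (𝓕 : Set (Finset (V × Fin k))).PairwiseDisjoint id
  have h𝓢 : 𝓢.Nonempty := ⟨∅, by simp [𝓢]⟩
  obtain ⟨𝓕, h𝓕, hmax⟩ := Finset.exists_max_image 𝓢 Finset.card h𝓢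
  obtain ⟨hsub, hgood, hdisj⟩ := mem_filter.1 h𝓕
  have hsub' : ∀ G ∈ 𝓕, G ⊆ X := fun G hG => mem_powerset.1 (mem_powerset.1 hsub hG)
  refine ⟨𝓕, fun G hG => ⟨hgood G hG, hsub' G hG⟩, hdisj, ?_⟩
  let Y := X \ 𝓕.biUnion id
  have hbi : #(𝓕.biUnion id) ≤ #𝓕 * s :=
    card_biUnion_le_card_mul _ _ _ fun G hG => (hgood G hG).1.le
  have hX : #X = #W * k := by simp [X]
  have hY : #X ≤ #Y + #(𝓕.biUnion id) := by
    have := Finset.le_card_sdiff (𝓕.biUnion id) X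
    change #X - _ ≤ #Y at this
    omega
  have hYle : #Y ≤ k * R * Fintype.card F * M := by
    by_contra! hlt
    let lab : V × Fin k → Fin k × Fin R × F := fun p => (p.2, g p.1 p.2, e p.2 p.1)
    obtain ⟨l, -, hl⟩ := Finset.exists_lt_card_fiber_of_mul_lt_card_of_maps_to (s := Y)
      (t := univ) (f := lab) (n := M) (fun _ _ => mem_univ _) (by
        rw [card_univ]
        simp only [Fintype.card_prod, Fintype.card_fin]
        linarith [hlt, mul_assoc (k : ℕ) R (Fintype.card F)])
    obtain ⟨Z, hZ, hZM⟩ := Finset.exists_subset_card_eq hl.le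
    have hZlab : ∀ p ∈ Z, lab p = l := fun p hp => (mem_filter.1 (hZ hp)).2
    have hZY : ∀ p ∈ Z, p ∈ Y := fun p hp => (mem_filter.1 (hZ hp)).1
    have hZ2 : ∀ p ∈ Z, p.2 = l.1 := fun p hp => congrArg Prod.fst (hZlab p hp)
    have hZpart : ∀ p ∈ Z, ∀ p' ∈ Z, OnPart e g l.1 p.1 p'.1 := by
      intro p hp p' hp'
      have h₁ := hZlab p hp
      have h₂ := hZlab p' hp'
      have e₁ := hZ2 p hp
      have e₂ := hZ2 p' hp'
      have h₃ : g p.1 p.2 = g p'.1 p'.2 := congrArg (fun t => t.2.1) (h₁.trans h₂.symm)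
      have h₄ : e p.2 p.1 = e p'.2 p'.1 := congrArg (fun t => t.2.2) (h₁.trans h₂.symm)
      rw [e₁, e₂] at h₃ h₄
      exact ⟨h₄, h₃⟩
    have hinj : Set.InjOn Prod.fst (Z : Set (V × Fin k)) := fun p hp p' hp' h =>
      Prod.ext h ((hZ2 p hp).trans (hZ2 p' hp').symm)
    obtain ⟨I, hIS, hIs, hIbad⟩ := hg l.1 (Z.image Prod.fst)
      (by rw [card_image_of_injOn hinj, hZM])
      (by
        intro u hu v hv
        obtain ⟨p, hp, rfl⟩ := mem_image.1 hu
        obtain ⟨p', hp', rfl⟩ := mem_image.1 hv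
        exact hZpart p hp p' hp')
    let G : Finset (V × Fin k) := I.image fun v => (v, l.1)
    have hGs : #G = s := by
      rw [card_image_of_injective _ (fun u v h => congrArg Prod.fst h), hIs]
    have hGZ : G ⊆ Z := by
      intro p hp
      obtain ⟨v, hv, rfl⟩ := mem_image.1 hp
      obtain ⟨p', hp', rfl⟩ := mem_image.1 (hIS hv)
      rw [← hZ2 p' hp']
      exact hp'
    have hGY : ∀ p ∈ G, p ∈ Y := fun p hp => hZY p (hGZ hp)
    have hGgood : IsGoodGroup e g s G := by
      refine ⟨hGs, fun p hp p' hp' => ?_⟩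
      have e₁ := hZ2 p (hGZ hp)
      have e₂ := hZ2 p' (hGZ hp')
      refine ⟨e₁.trans e₂.symm, e₁ ▸ hZpart p (hGZ hp) p' (hGZ hp'), fun hne => ?_⟩
      rw [e₁]
      obtain ⟨u, hu, rfl⟩ := mem_image.1 hp
      obtain ⟨v, hv, rfl⟩ := mem_image.1 hp'
      exact hIbad u hu v hv fun h => hne (h ▸ rfl)
    have hGd : ∀ G' ∈ 𝓕, Disjoint G G' := by
      intro G' hG'
      refine Finset.disjoint_left.2 fun p hp hp' => ?_
      exact (mem_sdiff.1 (hGY p hp)).2 (mem_biUnion.2 ⟨G', hG', hp'⟩)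
    -- A member of `𝓕` would be disjoint from itself, impossible as `s > 0`.
    have hGn : G ∉ 𝓕 := by
      intro h
      have := hGd G h
      rw [disjoint_self_iff_empty] at this
      rw [this, card_empty] at hGs
      omega
    have hmem : insert G 𝓕 ∈ 𝓢 := by
      refine mem_filter.2 ⟨mem_powerset.2 (insert_subset_iff.2 ⟨mem_powerset.2 fun p hp =>
        (mem_sdiff.1 (hGY p hp)).1, mem_powerset.1 hsub⟩), ?_, ?_⟩
      · intro G' hG'
        rcases mem_insert.1 hG' with rfl | h
        · exact hGgood
        · exact hgood G' h
      · rw [coe_insert]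
        exact hdisj.insert fun G' hG' _ => hGd G' hG'
    have := hmax _ hmem
    rw [card_insert_of_notMem hGn] at this
    omega
  have h5 : 2 * (k * R * Fintype.card F * M) ≤ #W * k := by
    calc 2 * (k * R * Fintype.card F * M) = (2 * (R * Fintype.card F * M)) * k := by ring
      _ ≤ _ := Nat.mul_le_mul_right _ hW
  have h6 : #𝓕 * s = s * #𝓕 := mul_comm _ _
  omega

theorem not_cliqueFreeOn_of_injOn {e : Fin k → V → F} {g : V → Fin k → Fin R}
    {c : V × Fin k → Fin s} {G : Finset (V × Fin k)} (hG : IsGoodGroup e g s G) {W : Finset V}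
    (hGW : G ⊆ W ×ˢ univ) (hc : Set.InjOn c G) :
    ¬ (partGraph e g c).CliqueFreeOn (W : Set V) s := by
  classical
  intro hW
  have hinj : Set.InjOn Prod.fst (G : Set (V × Fin k)) := fun p hp p' hp' h =>
    Prod.ext h (hG.2 p hp p' hp').1
  refine hW (t := G.image Prod.fst) ?_ ⟨?_, by rw [card_image_of_injOn hinj, hG.1]⟩
  · intro v hv
    obtain ⟨p, hp, rfl⟩ := mem_image.1 (mem_coe.1 hv)
    exact mem_coe.2 (mem_product.1 (hGW hp)).1
  · intro u hu v hv huv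
    obtain ⟨p, hp, rfl⟩ := mem_image.1 (mem_coe.1 hu)
    obtain ⟨p', hp', rfl⟩ := mem_image.1 (mem_coe.1 hv)
    have hne : p ≠ p' := fun h => huv (h ▸ rfl)
    obtain ⟨h₁, h₂, h₃⟩ := hG.2 p hp p' hp'
    refine ⟨p.2, h₂, fun h => hne (hc hp hp' ?_), h₃ hne⟩
    have e₂ : (p'.1, p.2) = p' := Prod.ext rfl h₁
    rwa [e₂] at h

theorem exists_graph_of_hasGoodSubsets [Fintype V] [Fintype F] {M w : ℕ} {e : Fin k → V → F}
    (he : IsLinearSpace e) {g : V → Fin k → Fin R} (hg : HasGoodSubsets e g M s)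
    (hs : 2 ≤ s) (hw : 2 * (R * Fintype.card F * M) ≤ w)
    (hprob : ∀ N : ℕ, w * k ≤ 2 * (s * N) →
      (Fintype.card V : ℝ) ^ w * (1 - ((s : ℝ) ^ s)⁻¹) ^ N < 1) :
    ∃ G : SimpleGraph V, G.CliqueFree (s + 1) ∧
      ∀ W : Finset V, w ≤ #W → ¬ G.CliqueFreeOn (W : Set V) s := by
  classical
  have hs0 : 0 < s := by omega
  have h𝓕 : ∀ W : Finset V, ∃ 𝓕 : Finset (Finset (V × Fin k)), #W = w →
      (∀ G ∈ 𝓕, IsGoodGroup e g s G ∧ G ⊆ W ×ˢ univ) ∧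
      (𝓕 : Set (Finset (V × Fin k))).PairwiseDisjoint id ∧ w * k ≤ 2 * (s * #𝓕) := by
    intro W
    by_cases hW : #W = w
    · obtain ⟨𝓕, h⟩ := exists_disjoint_goodGroups hg hs0 W (hW ▸ hw)
      exact ⟨𝓕, fun _ => hW ▸ h⟩
    · exact ⟨∅, fun h => absurd h hW⟩
  choose 𝓕 h𝓕 using h𝓕
  let 𝓑 : Finset V → Finset (V × Fin k → Fin s) := fun W => {c | ∀ G ∈ 𝓕 W, ¬ Set.InjOn c G}
  have hpos : (0 : ℝ) < (s : ℝ) ^ Fintype.card (V × Fin k) := by positivity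
  have hlt : #((univ.powersetCard w).biUnion 𝓑) < #(univ : Finset (V × Fin k → Fin s)) := by
    have hb : ∀ W ∈ (univ : Finset V).powersetCard w, (#(𝓑 W) : ℝ) * (Fintype.card V : ℝ) ^ w <
        (s : ℝ) ^ Fintype.card (V × Fin k) := by
      intro W hW
      obtain ⟨h₁, h₂, h₃⟩ := h𝓕 W (mem_powersetCard.1 hW).2
      have h₄ : (#(𝓑 W) : ℝ) ≤
          (1 - ((s : ℝ) ^ s)⁻¹) ^ #(𝓕 W) * (s : ℝ) ^ Fintype.card (V × Fin k) := by
        convert card_filter_forall_not_injOn_le (𝓕 W) (fun G hG => (h₁ G hG).1.1) h₂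
      have h₅ := hprob _ h₃
      calc (#(𝓑 W) : ℝ) * (Fintype.card V : ℝ) ^ w
          ≤ ((1 - ((s : ℝ) ^ s)⁻¹) ^ #(𝓕 W) * (s : ℝ) ^ Fintype.card (V × Fin k)) *
            (Fintype.card V : ℝ) ^ w := by gcongr
        _ = ((Fintype.card V : ℝ) ^ w * (1 - ((s : ℝ) ^ s)⁻¹) ^ #(𝓕 W)) *
            (s : ℝ) ^ Fintype.card (V × Fin k) := by ring
        _ < 1 * (s : ℝ) ^ Fintype.card (V × Fin k) := by gcongr
        _ = _ := one_mul _
    have hcard : (#((univ : Finset V).powersetCard w) : ℝ) ≤ (Fintype.card V : ℝ) ^ w := by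
      rw [card_powersetCard, card_univ]
      exact_mod_cast Nat.choose_le_pow _ _
    rw [card_univ, Fintype.card_fun, Fintype.card_fin]
    -- If `w` exceeds the number of points, every colouring works; the strict sum below needs a
    -- nonempty index set.
    rcases Finset.eq_empty_or_nonempty ((univ : Finset V).powersetCard w) with h0 | hne
    · rw [h0, biUnion_empty, card_empty]
      positivity
    have hV : (0 : ℝ) < (Fintype.card V : ℝ) ^ w := by
      have : 0 < #((univ : Finset V).powersetCard w) := hne.card_pos
      exact lt_of_lt_of_le (by exact_mod_cast this) hcard
    have h1 : (#((univ.powersetCard w).biUnion 𝓑) : ℝ) * (Fintype.card V : ℝ) ^ w <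
        (s : ℝ) ^ Fintype.card (V × Fin k) * (Fintype.card V : ℝ) ^ w := by
      calc (#((univ.powersetCard w).biUnion 𝓑) : ℝ) * (Fintype.card V : ℝ) ^ w
          ≤ (∑ W ∈ univ.powersetCard w, (#(𝓑 W) : ℝ)) * (Fintype.card V : ℝ) ^ w := by
            gcongr
            exact_mod_cast card_biUnion_le
        _ = ∑ W ∈ univ.powersetCard w, (#(𝓑 W) : ℝ) * (Fintype.card V : ℝ) ^ w :=
            Finset.sum_mul _ _ _
        _ < ∑ _W ∈ (univ : Finset V).powersetCard w, (s : ℝ) ^ Fintype.card (V × Fin k) :=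
            Finset.sum_lt_sum_of_nonempty hne hb
        _ = #((univ : Finset V).powersetCard w) * (s : ℝ) ^ Fintype.card (V × Fin k) := by
            rw [Finset.sum_const, nsmul_eq_mul]
        _ ≤ _ := by rw [mul_comm]; gcongr
    exact_mod_cast lt_of_mul_lt_mul_right h1 hV.le
  obtain ⟨c, -, hc⟩ := Finset.exists_mem_notMem_of_card_lt_card hlt
  refine ⟨partGraph e g c, partGraph_cliqueFree he hs g c, fun W hW => ?_⟩
  obtain ⟨W', hW', hcW⟩ := Finset.exists_subset_card_eq hW
  have h1 : c ∉ 𝓑 W' := fun h =>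
    hc (mem_biUnion.2 ⟨W', mem_powersetCard.2 ⟨subset_univ _, hcW⟩, h⟩)
  have h2 : ∃ G ∈ 𝓕 W', Set.InjOn c G := by
    by_contra! hcon
    exact h1 (mem_filter.2 ⟨mem_univ _, hcon⟩)
  obtain ⟨G, hG, hinj⟩ := h2
  obtain ⟨h₁, h₂⟩ := (h𝓕 W' hcW).1 G hG
  exact not_cliqueFreeOn_of_injOn h₁ (h₂.trans (product_subset_product_left hW')) hinj

end Construction

/-! ### The affine plane and the choice of parameters. -/

/-- The lines of slope `0, 1, …, k - 1` in the affine plane over `ZMod q`. -/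
def affineClass (q k : ℕ) (j : Fin k) (v : ZMod q × ZMod q) : ZMod q := v.2 + (j : ℕ) * v.1

theorem isLinearSpace_affineClass {q k : ℕ} [Fact q.Prime] (hk : k ≤ q) :
    IsLinearSpace (affineClass q k) := by
  intro i j u v hij h₁ h₂
  have hne : ((i : ℕ) : ZMod q) - ((j : ℕ) : ZMod q) ≠ 0 := by
    intro h
    rw [sub_eq_zero, ZMod.natCast_eq_natCast_iff'] at h
    rw [Nat.mod_eq_of_lt (i.2.trans_le hk), Nat.mod_eq_of_lt (j.2.trans_le hk)] at h
    exact hij (Fin.ext h)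
  simp only [affineClass] at h₁ h₂
  have h₃ : (((i : ℕ) : ZMod q) - ((j : ℕ) : ZMod q)) * (u.1 - v.1) = 0 := by
    linear_combination h₁ - h₂
  have h₄ : u.1 = v.1 := sub_eq_zero.1 ((mul_eq_zero.1 h₃).resolve_left hne)
  rw [h₄] at h₁
  exact Prod.ext h₄ (add_right_cancel h₁)

theorem exists_graph_affinePlane {s k q : ℕ} (hq : q.Prime) (hs : 2 ≤ s) (hkq : k ≤ q)
    (hk : 4 * (s : ℝ) ^ (s + 1) * Real.log q < k) :
    ∃ G : SimpleGraph (ZMod q × ZMod q), G.CliqueFree (s + 1) ∧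
      ∀ W : Finset (ZMod q × ZMod q), 416 * s ^ 3 * k ^ 7 * q ≤ #W →
        ¬ G.CliqueFreeOn (W : Set (ZMod q × ZMod q)) s := by
  have : Fact q.Prime := ⟨hq⟩
  have hq1 : (1 : ℝ) < q := by exact_mod_cast hq.one_lt
  have hlog : 0 < Real.log q := Real.log_pos hq1
  have hs' : (2 : ℝ) ≤ s := by exact_mod_cast hs
  have hspow : (1 : ℝ) ≤ (s : ℝ) ^ (s + 1) := one_le_pow₀ (by linarith)
  have hk2 : 2 * Real.log q ≤ k := by nlinarith
  have hk0 : 0 < k := by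
    have : (0 : ℝ) < k := by linarith
    exact_mod_cast this
  have hk1 : (1 : ℝ) ≤ k := by exact_mod_cast hk0
  have hs0 : 0 < s := by omega
  have hqpos : 0 < q := hq.pos
  have hqexp : (q : ℝ) = Real.exp (Real.log q) := (Real.exp_log (by linarith)).symm
  have hV : (Fintype.card (ZMod q × ZMod q) : ℝ) = Real.exp (2 * Real.log q) := by
    rw [Fintype.card_prod, ZMod.card]
    push_cast
    rw [two_mul, Real.exp_add, ← hqexp]
  have he := isLinearSpace_affineClass (q := q) hkq
  -- `T` is exactly `M² / (4sk²)`. As `q² ≤ e^k`, the union bound costs at most `52s²k⁶ + 208s³k⁸`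
  -- in the exponent and the mean `338s²k⁸`; for `s ≥ 2` these total at most `403s³k⁸ < T`.
  obtain ⟨g, hg⟩ := exists_hasGoodSubsets (M := 52 * s ^ 2 * k ^ 5) (T := 676 * s ^ 3 * k ^ 8)
    (R := 4 * s * k ^ 2) he hs
    (by
      have h1 : 1 ≤ k ^ 5 := Nat.one_le_pow _ _ hk0
      have h2 : s ≤ s ^ 2 := Nat.le_self_pow (by norm_num) s
      nlinarith [Nat.mul_le_mul h2 h1]) hk0 (by positivity)
    (le_of_eq (by ring))
    (by
      have hRk : (((4 * s * k ^ 2 : ℕ) : ℝ)) ^ k ≤ Real.exp (k * (4 * s * k ^ 2)) := by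
        rw [Real.exp_nat_mul]
        refine pow_le_pow_left₀ (by positivity) ?_ _
        push_cast
        linarith [Real.add_one_le_exp (4 * (s : ℝ) * k ^ 2)]
      have h1 : ((Fintype.card (ZMod q × ZMod q) : ℝ) * ((4 * s * k ^ 2 : ℕ) : ℝ) ^ k) ^
          (52 * s ^ 2 * k ^ 5) ≤
          Real.exp ((52 * s ^ 2 * k ^ 5 : ℕ) * (k + k * (4 * s * k ^ 2))) := by
        rw [Real.exp_nat_mul, Real.exp_add]
        refine pow_le_pow_left₀ (by positivity) ?_ _
        rw [hV]
        gcongr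
      refine (mul_le_mul_of_nonneg_right h1 (Real.exp_pos _).le).trans_lt ?_
      rw [← Real.exp_add, Real.exp_lt_one_iff]
      have h2 : (2 * ((((52 * s ^ 2 * k ^ 5 : ℕ) : ℝ)) ^ 2 * k ^ 2 / ((4 * s * k ^ 2 : ℕ) : ℝ) ^ 2)) =
          338 * s ^ 2 * k ^ 8 := by
        push_cast
        field_simp
        ring
      rw [h2]
      push_cast
      have h3 : (s : ℝ) ^ 2 * k ^ 8 * 2 ≤ s ^ 2 * k ^ 8 * s := by gcongr
      have h4 : (s : ℝ) ^ 2 * k ^ 6 ≤ s ^ 2 * k ^ 8 := by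
        gcongr
        norm_num
      have h5 : (0 : ℝ) < s ^ 2 * k ^ 8 := by positivity
      nlinarith)
  -- The threshold `416s³k⁷q` is `2RqM`.
  refine exists_graph_of_hasGoodSubsets he hg hs (le_of_eq (by rw [ZMod.card]; ring)) ?_
  intro N hN
  have hw : (0 : ℝ) < ((416 * s ^ 3 * k ^ 7 * q : ℕ) : ℝ) := by
    have : 0 < 416 * s ^ 3 * k ^ 7 * q := by positivity
    exact_mod_cast this
  set w := 416 * s ^ 3 * k ^ 7 * q
  have hN' : (w : ℝ) * k ≤ 2 * (s * N) := by exact_mod_cast hN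
  have hx : 1 - ((s : ℝ) ^ s)⁻¹ ≤ Real.exp (-((s : ℝ) ^ s)⁻¹) := by
    linarith [Real.add_one_le_exp (-((s : ℝ) ^ s)⁻¹)]
  have hx0 : 0 ≤ 1 - ((s : ℝ) ^ s)⁻¹ := by
    rw [sub_nonneg]
    exact inv_le_one_of_one_le₀ (one_le_pow₀ (by linarith))
  rw [hV]
  calc Real.exp (2 * Real.log q) ^ w * (1 - ((s : ℝ) ^ s)⁻¹) ^ N
      ≤ Real.exp (2 * Real.log q) ^ w * Real.exp (-((s : ℝ) ^ s)⁻¹) ^ N := by gcongr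
    _ = Real.exp (w * (2 * Real.log q) + N * (-((s : ℝ) ^ s)⁻¹)) := by
      rw [Real.exp_add, Real.exp_nat_mul, Real.exp_nat_mul]
    _ < 1 := by
      rw [Real.exp_lt_one_iff]
      have hss : (0 : ℝ) < (s : ℝ) ^ s := by positivity
      have h1 : (w : ℝ) * (2 * Real.log q) * (s : ℝ) ^ s < N := by
        have h2 : (w : ℝ) * (4 * (s : ℝ) ^ (s + 1) * Real.log q) < w * k := by gcongr
        have h3 : (2 * s : ℝ) * (w * (2 * Real.log q) * (s : ℝ) ^ s) < (2 * s) * N := by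
          calc (2 * s : ℝ) * (w * (2 * Real.log q) * (s : ℝ) ^ s)
              = (w : ℝ) * (4 * (s : ℝ) ^ (s + 1) * Real.log q) := by ring
            _ < w * k := h2
            _ ≤ _ := by linarith
        exact lt_of_mul_lt_mul_left h3 (by positivity)
      have h4 : (w : ℝ) * (2 * Real.log q) < N * ((s : ℝ) ^ s)⁻¹ := by
        rwa [← div_eq_mul_inv, lt_div_iff₀ hss]
      linarith

/-! ### From prime squares to all `n`. -/

theorem exists_graph_fin_of_card_le {V : Type*} [Fintype V] {n s w : ℕ} (hn : n ≤ Fintype.card V)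
    (G : SimpleGraph V) (hG : G.CliqueFree (s + 1))
    (hW : ∀ W : Finset V, w ≤ #W → ¬ G.CliqueFreeOn (W : Set V) s) :
    ∃ G : SimpleGraph (Fin n), G.CliqueFree (s + 1) ∧
      ∀ W : Finset (Fin n), w ≤ #W → ¬ G.CliqueFreeOn (W : Set (Fin n)) s := by
  classical
  obtain ⟨f⟩ : Nonempty (Fin n ↪ V) :=
    Function.Embedding.nonempty_of_card_le (by rwa [Fintype.card_fin])
  refine ⟨G.comap f, hG.comap ⟨(SimpleGraph.Embedding.comap f G).toHom.toCopy f.injective⟩, fun W hw hfree => ?_⟩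
  refine hW (W.map f) (by rwa [card_map]) fun t ht hc => ?_
  have hmem : ∀ v ∈ t, ∃ u ∈ W, f u = v := fun v hv => by
    simpa using ht (mem_coe.2 hv)
  obtain ⟨t', ht', rfl⟩ : ∃ t' ⊆ W, t'.map f = t := by
    obtain ⟨t', h₁, h₂⟩ := Finset.subset_map_iff.1 (show t ⊆ W.map f by exact_mod_cast ht)
    exact ⟨t', h₁, h₂.symm⟩
  refine hfree (t := t') (by exact_mod_cast ht') ⟨?_, by rw [← hc.card_eq, card_map]⟩
  intro u hu v hv huv
  exact hc.isClique (mem_coe.2 (mem_map_of_mem f hu)) (mem_coe.2 (mem_map_of_mem f hv))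
    (f.injective.ne huv)

theorem exists_graph_eventually {s : ℕ} (hs : 2 ≤ s) :
    ∃ C : ℝ, 0 < C ∧ ∃ n₀ : ℕ, ∀ n : ℕ, n₀ ≤ n →
      ∃ G : SimpleGraph (Fin n), G.CliqueFree (s + 1) ∧ ∀ W : Finset (Fin n),
        C * Real.log n ^ 7 * Real.sqrt n ≤ (#W : ℝ) → ¬ G.CliqueFreeOn (W : Set (Fin n)) s := by
  set A : ℝ := 4 * (s : ℝ) ^ (s + 1) with hA
  have hs0 : 0 < s := by omega
  have hA0 : 0 < A := by positivity
  have hlim : ∀ᶠ n : ℕ in Filter.atTop, (A + 1) * Real.log n ≤ Real.sqrt n := by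
    have h := (isLittleO_log_rpow_atTop (show (0 : ℝ) < 1 / 2 by norm_num)).comp_tendsto
      tendsto_natCast_atTop_atTop
    have h' := h.def (show (0 : ℝ) < (A + 1)⁻¹ by positivity)
    filter_upwards [h', Filter.eventually_ge_atTop 1] with n hn hn1
    have hn1' : (1 : ℝ) ≤ n := by exact_mod_cast hn1
    simp only [Function.comp, Real.norm_eq_abs] at hn
    rw [abs_of_nonneg (Real.log_nonneg hn1'), abs_of_nonneg (by positivity),
      ← Real.sqrt_eq_rpow] at hn
    rwa [le_inv_mul_iff₀ (by positivity)] at hn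
  obtain ⟨n₁, hn₁⟩ := Filter.eventually_atTop.1 hlim
  refine ⟨1664 * s ^ 3 * (A + 1) ^ 7, by positivity, max n₁ 16, fun n hn => ?_⟩
  have hn16 : 16 ≤ n := (le_max_right _ _).trans hn
  have hnA := hn₁ n ((le_max_left _ _).trans hn)
  have hn16' : (16 : ℝ) ≤ n := by exact_mod_cast hn16
  have hnpos : (0 : ℝ) < n := by linarith
  have hsq4 : 4 ≤ Real.sqrt n := Real.le_sqrt_of_sq_le (by linarith)
  have hsqsq : Real.sqrt n * Real.sqrt n = n := Real.mul_self_sqrt hnpos.le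
  have hlog1 : 1 ≤ Real.log n := by
    rw [Real.le_log_iff_exp_le hnpos]
    linarith [Real.exp_one_lt_d9]
  -- Bertrand's postulate: the plane has at least `n` points, while `q ≤ 4√n`; for `n ≥ 16` this
  -- also gives `q ≤ n`.
  obtain ⟨q, hq, hq1, hq2⟩ := Nat.exists_prime_lt_and_le_two_mul (Nat.sqrt n + 1) (by omega)
  have hqn : n ≤ q * q := by
    have h1 := Nat.lt_succ_sqrt n
    have h2 : Nat.succ (Nat.sqrt n) ≤ q := hq1.le
    nlinarith
  have hq4 : (q : ℝ) ≤ 4 * Real.sqrt n := by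
    have h1 : (q : ℝ) ≤ 2 * (Nat.sqrt n + 1) := by exact_mod_cast hq2
    have h2 := Real.nat_sqrt_le_real_sqrt (a := n)
    linarith
  have hqs : Real.sqrt n ≤ q := by
    rw [Real.sqrt_le_left (by positivity), sq]
    exact_mod_cast hqn
  have hqpos : (0 : ℝ) < q := by linarith
  have hlogq : Real.log q ≤ Real.log n := Real.log_le_log hqpos (by nlinarith)
  have hlogq0 : 0 ≤ Real.log q := Real.log_nonneg (by linarith)
  set k := ⌊A * Real.log q⌋₊ + 1 with hk
  have hkle : (k : ℝ) ≤ (A + 1) * Real.log n := by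
    have h1 := Nat.floor_le (show 0 ≤ A * Real.log q by positivity)
    have h2 : A * Real.log q ≤ A * Real.log n := by gcongr
    rw [hk]
    push_cast
    linarith
  have hkq : k ≤ q := by
    have : (k : ℝ) ≤ q := by linarith
    exact_mod_cast this
  have hkA : A * Real.log q < k := by
    rw [hk]
    push_cast
    exact Nat.lt_floor_add_one _
  obtain ⟨G, hG, hW⟩ := exists_graph_affinePlane hq hs hkq hkA
  have : NeZero q := ⟨hq.ne_zero⟩
  obtain ⟨G', hG', hW'⟩ := exists_graph_fin_of_card_le (n := n)
    (by rw [Fintype.card_prod, ZMod.card]; exact hqn) G hG hW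
  refine ⟨G', hG', fun W hw => hW' W ?_⟩
  have hbound : ((416 * s ^ 3 * k ^ 7 * q : ℕ) : ℝ) ≤ #W := by
    refine le_trans ?_ hw
    push_cast
    calc (416 : ℝ) * s ^ 3 * k ^ 7 * q
        ≤ 416 * s ^ 3 * ((A + 1) * Real.log n) ^ 7 * (4 * Real.sqrt n) := by gcongr
      _ = _ := by ring
  exact_mod_cast hbound

theorem erdosRogers_le_of_graph {s n : ℕ} (hs : 1 ≤ s) {b : ℝ} (G : SimpleGraph (Fin n))
    (hG : G.CliqueFree (s + 1))
    (hW : ∀ W : Finset (Fin n), b ≤ (#W : ℝ) → ¬ G.CliqueFreeOn (W : Set (Fin n)) s) :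
    (erdosRogers s (s + 1) n : ℝ) ≤ b := by
  have h1 : erdosRogers s (s + 1) n ≤ sIndepNum G s :=
    (isLeast_erdosRogers s n (by omega)).2 ⟨G, hG, rfl⟩
  obtain ⟨W, hWc, hfree⟩ := (isGreatest_sIndepNum G hs).1
  have h2 : (#W : ℝ) < b := not_le.1 fun h => hW W h hfree
  rw [hWc] at h2
  exact le_trans (by exact_mod_cast h1) h2.le

theorem theorem1 (s : ℕ) (hs : 3 ≤ s) :
    ∃ c : ℝ, 0 < c ∧ ∀ n : ℕ, 2 ≤ n →
      (erdosRogers s (s + 1) n : ℝ) ≤ c * Real.log (n : ℝ) ^ (4 * s ^ 2) * Real.sqrt (n : ℝ) ∧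
      ∃ G : SimpleGraph (Fin n), G.CliqueFree (s + 1) ∧
        ∀ W : Finset (Fin n),
          c * Real.log (n : ℝ) ^ (4 * s ^ 2) * Real.sqrt (n : ℝ) ≤ (W.card : ℝ) →
          ¬ G.CliqueFreeOn (W : Set (Fin n)) s := by
  obtain ⟨C, hC, n₀, hmain⟩ := exists_graph_eventually (show 2 ≤ s by omega)
  have hlog2 : 0 < Real.log 2 := Real.log_pos (by norm_num)
  have hpow : 0 < Real.log 2 ^ (4 * s ^ 2) := by positivity
  -- The second summand pushes the bound above `n` when `n < max n₀ 3`, where the claim is vacuous.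
  -- From `n ≥ 3` on, `log n ≥ 1` lets the exponent grow from `7` to `4s²`.
  refine ⟨C + (n₀ + 3) / Real.log 2 ^ (4 * s ^ 2), by positivity, fun n hn => ?_⟩
  suffices h : ∃ G : SimpleGraph (Fin n), G.CliqueFree (s + 1) ∧ ∀ W : Finset (Fin n),
      (C + (n₀ + 3) / Real.log 2 ^ (4 * s ^ 2)) * Real.log (n : ℝ) ^ (4 * s ^ 2) *
        Real.sqrt (n : ℝ) ≤ (W.card : ℝ) → ¬ G.CliqueFreeOn (W : Set (Fin n)) s by
    obtain ⟨G, hG, hW⟩ := h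
    exact ⟨erdosRogers_le_of_graph (by omega) G hG hW, G, hG, hW⟩
  have hn2 : (2 : ℝ) ≤ n := by exact_mod_cast hn
  have hlogn : Real.log 2 ≤ Real.log n := Real.log_le_log (by norm_num) hn2
  rcases le_or_gt (max n₀ 3) n with hlarge | hsmall
  · obtain ⟨G, hG, hW⟩ := hmain n ((le_max_left _ _).trans hlarge)
    refine ⟨G, hG, fun W hw => hW W (le_trans ?_ hw)⟩
    have hn3 : (3 : ℝ) ≤ n := by exact_mod_cast (le_max_right _ _).trans hlarge
    have hlog1 : 1 ≤ Real.log n := by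
      rw [Real.le_log_iff_exp_le (by linarith)]
      linarith [Real.exp_one_lt_d9]
    have h7 : 7 ≤ 4 * s ^ 2 := by nlinarith
    gcongr
    exact le_add_of_nonneg_right (by positivity)
  · refine ⟨⊥, SimpleGraph.cliqueFree_bot (by omega), fun W hw => absurd hw (not_le.2 ?_)⟩
    have hnlt : (n : ℝ) < n₀ + 3 := by
      have : n < n₀ + 3 := by omega
      exact_mod_cast this
    have hWn : (#W : ℝ) ≤ n := by
      have := card_le_univ W
      rw [Fintype.card_fin] at this
      exact_mod_cast this
    have hsqrt : 1 ≤ Real.sqrt n := Real.one_le_sqrt.2 (by linarith)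
    calc (#W : ℝ) ≤ n := hWn
      _ < n₀ + 3 := hnlt
      _ = (n₀ + 3) / Real.log 2 ^ (4 * s ^ 2) * Real.log 2 ^ (4 * s ^ 2) * 1 := by
        rw [mul_one, div_mul_cancel₀ _ hpow.ne']
      _ ≤ _ := by
        gcongr
        exact le_add_of_nonneg_left hC.le
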